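/- Let $(S,d)$ be a complete separable metric space with its Borel $\sigma$-algebra, and let $\mathcal M^+(S)$ be the cone of finite positive Borel measures on $S$. For a finite signed Borel measure $\sigma$ put $$\|\sigma\|_{\mathrm{BL},d}^*=\sup\Big\{\Big|\int_S f\,d\sigma\Big| : f:S\to\mathbb R \text{ bounded and Lipschitz},\ \|f\|_\infty+|f|_{L,d}\le 1\Big\},$$ where $|f|_{L,d}=\sup_{x\ne y}|f(x)-f(y)|/d(x,y)$. A Markov operator on $S$ is an additive and $\mathbb R_+$-homogeneous map $P:\mathcal M^+(S)\to\mathcal M^+(S)$ with $(P\mu)(S)=\mu(S)$ for all $\mu$. A family $(P_\lambda)_{\lambda\in\Lambda}$ of Markov operators is equicontinuous if for every $\mu\in\mathcal M^+(S)$ and every $\varepsilon>0$ there is $\delta>0$ such that $\|P_\lambda\mu-P_\lambda\nu\|_{\mathrm{BL},d}^*<\varepsilon$ for all $\lambda\in\Lambda$ and all $\nu\in\mathcal M^+(S)$ with $\|\mu-\nu\|_{\mathrm{BL},d}^*<\delta$. It is tight if for every $\mu\in\mathcal M^+(S)$ and every $\varepsilon>0$ there is a compact set $K\subset S$ with $(P_\lambda\mu)(S\setminus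 K)\le\varepsilon$ for all $\lambda\in\Lambda$. **Theorem.** (1) Let $(P_\lambda)_{\lambda\in\Lambda}$ and $(Q_\gamma)_{\gamma\in\Gamma}$ be equicontinuous families of Markov operators on $S$, and assume that $(Q_\gamma)_{\gamma\in\Gamma}$ is tight. Then the family $\{P_\lambda Q_\gamma:\lambda\in\Lambda,\gamma\in\Gamma\}$ is equicontinuous. If moreover $(P_\lambda)_{\lambda\in\Lambda}$ is tight, then $\{P_\lambda Q_\gamma:\lambda\in\Lambda,\gamma\in\Gamma\}$ is tight. (2) Let $n\ge 0$ and let $(P^{(i)}_\lambda)_{\lambda\in\Lambda_i}$, $i=1,\dots,n$, be families of Markov operators on $S$, each of them equicontinuous and tight. Then the family $\{P^{(1)}_{\lambda_1}P^{(2)}_{\lambda_2}\cdots P^{(n)}_{\lambda_n}:\lambda_i\in\Lambda_i\}$ (consisting of the identity if $n=0$) is equicontinuous and tight. -/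

import Mathlib

open MeasureTheory
open scoped NNReal

noncomputable section

namespace MarkovComposition

section BoundedLipschitz

variable {S : Type*} [MetricSpace S]

/-- Membership in `BL(S,d)`: the bounded Lipschitz real functions on `S`. -/
def IsBL (f : S → ℝ) : Prop :=
  (∃ C : ℝ, ∀ x, |f x| ≤ C) ∧ ∃ K : ℝ≥0, LipschitzWith K f

/-- The Lipschitz constant `|f|_L` (equal to `0` if `S` has at most one point). -/
def lipConst (f : S → ℝ) : ℝ :=
  sSup {r : ℝ | ∃ x y : S, x ≠ y ∧ r = |f x - f y| / dist x y}

/-- The bounded Lipschitz norm `‖f‖_∞ + |f|_L`, used only for `f` in `BL(S,d)`,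
where both suprema are finite. -/
def blNorm (f : S → ℝ) : ℝ :=
  (⨆ x, |f x|) + lipConst f

variable [MeasurableSpace S]

/-- The pairing `⟨σ, f⟩`: the integral of `f` against the finite signed measure `σ`, taken through
the Jordan decomposition of `σ`. -/
def pairing (σ : SignedMeasure S) (f : S → ℝ) : ℝ :=
  (∫ x, f x ∂σ.toJordanDecomposition.posPart) - ∫ x, f x ∂σ.toJordanDecomposition.negPart

/-- The dual bounded Lipschitz norm on finite signed measures. The set is nonempty (`f = 0`) and
bounded above by the total variation of `σ`. -/
def blDualNorm (σ : SignedMeasure S) : ℝ :=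
  sSup {r : ℝ | ∃ f : S → ℝ, IsBL f ∧ blNorm f ≤ 1 ∧ r = |pairing σ f|}

end BoundedLipschitz

/-- A Markov operator on `S`: an additive, `ℝ₊`-homogeneous self-map of the cone of finite positive
measures that preserves the total variation norm, i.e. the total mass. -/
structure MarkovOperator (S : Type*) [MeasurableSpace S] where
  toFun : FiniteMeasure S → FiniteMeasure S
  map_add : ∀ μ ν, toFun (μ + ν) = toFun μ + toFun ν
  map_smul : ∀ (c : ℝ≥0) (μ : FiniteMeasure S), toFun (c • μ) = c • toFun μ
  mass_map : ∀ μ, (toFun μ).mass = μ.mass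

namespace MarkovOperator

variable {S : Type*} [MeasurableSpace S]

instance : CoeFun (MarkovOperator S) (fun _ => FiniteMeasure S → FiniteMeasure S) := ⟨toFun⟩

/-- The identity operator. -/
def id : MarkovOperator S where
  toFun μ := μ
  map_add _ _ := rfl
  map_smul _ _ := rfl
  mass_map _ := rfl

/-- The composition `P Q`, i.e. `μ ↦ P (Q μ)`. -/
def comp (P Q : MarkovOperator S) : MarkovOperator S where
  toFun μ := P (Q μ)
  map_add μ ν := by rw [Q.map_add, P.map_add]
  map_smul c μ := by rw [Q.map_smul, P.map_smul]
  mass_map μ := by rw [P.mass_map, Q.mass_map]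

/-- The composition `P₀ P₁ ⋯ Pₙ₋₁` (the identity if `n = 0`). -/
def compFin {n : ℕ} (P : Fin n → MarkovOperator S) : MarkovOperator S :=
  (List.ofFn P).foldr comp id

end MarkovOperator

/-- The finite signed measure `μ - ν` for finite positive measures `μ` and `ν`. -/
def signedSub {S : Type*} [MeasurableSpace S] (μ ν : FiniteMeasure S) : SignedMeasure S :=
  (μ : Measure S).toSignedMeasure - (ν : Measure S).toSignedMeasure

/-- Against a difference of finite positive measures, the pairing is the difference of the
integrals. -/
theorem pairing_signedSub {S : Type*} [MeasurableSpace S]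
    (μ ν : FiniteMeasure S) (f : S → ℝ) (hf : Measurable f) (hb : ∃ C : ℝ, ∀ x, |f x| ≤ C) :
    pairing (signedSub μ ν) f = (∫ x, f x ∂(μ : Measure S)) - ∫ x, f x ∂(ν : Measure S) := by
  obtain ⟨C, hC⟩ := hb
  have hi : ∀ (ρ : Measure S) [IsFiniteMeasure ρ], Integrable f ρ := fun ρ _ =>
    Integrable.of_bound hf.aestronglyMeasurable C (Filter.Eventually.of_forall hC)
  set σ := signedSub μ ν with hσ
  have h1 : σ.toJordanDecomposition.posPart.toSignedMeasure
      - σ.toJordanDecomposition.negPart.toSignedMeasure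
      = (μ : Measure S).toSignedMeasure - (ν : Measure S).toSignedMeasure :=
    σ.toSignedMeasure_toJordanDecomposition
  have h2 : σ.toJordanDecomposition.posPart + (ν : Measure S)
      = (μ : Measure S) + σ.toJordanDecomposition.negPart := by
    rw [← Measure.toSignedMeasure_eq_toSignedMeasure_iff, Measure.toSignedMeasure_add,
      Measure.toSignedMeasure_add]
    rw [sub_eq_sub_iff_add_eq_add] at h1
    exact h1
  have h3 := congrArg (fun ρ : Measure S => ∫ x, f x ∂ρ) h2
  beta_reduce at h3
  rw [integral_add_measure (hi _) (hi _), integral_add_measure (hi _) (hi _)] at h3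
  unfold pairing
  linarith

variable {S : Type*} [MetricSpace S] [MeasurableSpace S]

/-- Equicontinuity of a family of Markov operators at every `μ`, for the dual bounded Lipschitz
norm. -/
def EquicontinuousFamily {Λ : Type*} (P : Λ → MarkovOperator S) : Prop :=
  ∀ μ : FiniteMeasure S, ∀ ε : ℝ, 0 < ε → ∃ δ : ℝ, 0 < δ ∧
    ∀ ν : FiniteMeasure S, blDualNorm (signedSub μ ν) < δ →
      ∀ l : Λ, blDualNorm (signedSub (P l μ) (P l ν)) < ε

/-- Tightness of a family of Markov operators: every orbit `{P_λ μ}` is uniformly tight. -/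
def TightFamily {Λ : Type*} (P : Λ → MarkovOperator S) : Prop :=
  ∀ μ : FiniteMeasure S, IsTightMeasureSet (Set.range fun l : Λ => (P l μ : Measure S))

end MarkovComposition

end

open Filter Topology Set

namespace MarkovComposition

/-! ### The bounded Lipschitz norm and the distance it induces on finite measures. -/

section BoundedLipschitz

variable {S : Type*} [MetricSpace S]

/-! Tightness of `Q` and conservation of mass put the orbit of `μ` under `Q` inside a weakly compact
set `T` (Prokhorov), on which the bounded Lipschitz distance is weakly continuous
(`TightFamily.exists_isCompact`). Equicontinuity of `P` at each point of `T` therefore becomes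
uniform over `T` (`EquicontinuousFamily.exists_uniform`), and composing moduli gives equicontinuity
of the products.

For tightness, `T` is covered by finitely many small balls. Equicontinuity keeps every `P l ρ'`
close to `P l ρ` for the centre `ρ` of its ball, and the orbits of the finitely many centres share
one compact set up to small mass. In a complete space such approximate tightness implies tightness
(`isTightMeasureSet_of_forall_blDist_lt`). Part (2) is an induction on the number of factors. -/

theorem IsBL.bddAbove_range {f : S → ℝ} (hf : IsBL f) : BddAbove (range fun x => |f x|) := by
  obtain ⟨⟨C, hC⟩, -⟩ := hf
  exact ⟨C, by rintro _ ⟨x, rfl⟩; exact hC x⟩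

theorem IsBL.bddAbove_slopes {f : S → ℝ} (hf : IsBL f) :
    BddAbove {r : ℝ | ∃ x y : S, x ≠ y ∧ r = |f x - f y| / dist x y} := by
  obtain ⟨-, K, hK⟩ := hf
  refine ⟨K, ?_⟩
  rintro _ ⟨x, y, hxy, rfl⟩
  rw [div_le_iff₀ (dist_pos.2 hxy), ← Real.dist_eq]
  exact hK.dist_le_mul x y

theorem lipConst_nonneg (f : S → ℝ) : 0 ≤ lipConst f := by
  refine Real.sSup_nonneg ?_
  rintro _ ⟨x, y, -, rfl⟩
  positivity

theorem IsBL.abs_le_blNorm {f : S → ℝ} (hf : IsBL f) (x : S) : |f x| ≤ blNorm f :=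
  (le_ciSup hf.bddAbove_range x).trans (le_add_of_nonneg_right (lipConst_nonneg f))

theorem IsBL.abs_sub_le {f : S → ℝ} (hf : IsBL f) (x y : S) :
    |f x - f y| ≤ blNorm f * dist x y := by
  rcases eq_or_ne x y with rfl | hxy
  · simp
  rw [← div_le_iff₀ (dist_pos.2 hxy)]
  refine (le_csSup hf.bddAbove_slopes ⟨x, y, hxy, rfl⟩).trans ?_
  exact le_add_of_nonneg_left (Real.iSup_nonneg fun _ => abs_nonneg _)

theorem blNorm_le {f : S → ℝ} {a : ℝ} {b : ℝ≥0} (ha : 0 ≤ a) (hfa : ∀ x, |f x| ≤ a)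
    (hfb : LipschitzWith b f) : blNorm f ≤ a + b := by
  refine add_le_add (Real.iSup_le hfa ha) (Real.sSup_le ?_ b.2)
  rintro _ ⟨x, y, hxy, rfl⟩
  rw [div_le_iff₀ (dist_pos.2 hxy), ← Real.dist_eq]
  exact hfb.dist_le_mul x y

variable [MeasurableSpace S]

/-- The distance on finite positive measures induced by the dual bounded Lipschitz norm. -/
noncomputable abbrev blDist (μ ν : FiniteMeasure S) : ℝ := blDualNorm (signedSub μ ν)

theorem _root_.MeasureTheory.FiniteMeasure.measureReal_toMeasure {Ω : Type*} [MeasurableSpace Ω]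
    (ν : FiniteMeasure Ω) (s : Set Ω) : (ν : Measure Ω).real s = ν s :=
  rfl

theorem blDist_nonneg (μ ν : FiniteMeasure S) : 0 ≤ blDist μ ν := by
  refine Real.sSup_nonneg ?_
  rintro _ ⟨f, -, -, rfl⟩
  exact abs_nonneg _

variable [BorelSpace S]

theorem IsBL.measurable {f : S → ℝ} (hf : IsBL f) : Measurable f := by
  obtain ⟨-, K, hK⟩ := hf
  exact hK.continuous.measurable

theorem IsBL.pairing_signedSub {f : S → ℝ} (hf : IsBL f) (μ ν : FiniteMeasure S) :
    pairing (signedSub μ ν) f = (∫ x, f x ∂(μ : Measure S)) - ∫ x, f x ∂(ν : Measure S) :=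
  MarkovComposition.pairing_signedSub μ ν f hf.measurable hf.1

theorem blDist_le {μ ν : FiniteMeasure S} {c : ℝ} (hc : 0 ≤ c)
    (h : ∀ f : S → ℝ, IsBL f → blNorm f ≤ 1 →
      |(∫ x, f x ∂(μ : Measure S)) - ∫ x, f x ∂(ν : Measure S)| ≤ c) : blDist μ ν ≤ c := by
  refine Real.sSup_le ?_ hc
  rintro _ ⟨f, hf, hf1, rfl⟩
  rw [hf.pairing_signedSub]
  exact h f hf hf1

theorem abs_integral_sub_le_blDist (μ ν : FiniteMeasure S) {f : S → ℝ} (hf : IsBL f)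
    (hf1 : blNorm f ≤ 1) :
    |(∫ x, f x ∂(μ : Measure S)) - ∫ x, f x ∂(ν : Measure S)| ≤ blDist μ ν := by
  have hb : ∀ (g : S → ℝ), IsBL g → blNorm g ≤ 1 → ∀ ρ : FiniteMeasure S,
      |∫ x, g x ∂(ρ : Measure S)| ≤ ρ.mass := by
    intro g hg hg1 ρ
    have := norm_integral_le_of_norm_le_const (μ := (ρ : Measure S)) (f := g) (C := 1)
      (Eventually.of_forall fun x => (hg.abs_le_blNorm x).trans hg1)
    simpa [FiniteMeasure.measureReal_toMeasure, FiniteMeasure.mass] using this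
  rw [← hf.pairing_signedSub]
  -- The total mass bounds the set of pairings, so the real `sSup` is a genuine supremum rather than
  -- the default `0`.
  refine le_csSup ⟨μ.mass + ν.mass, ?_⟩ ⟨f, hf, hf1, rfl⟩
  rintro _ ⟨g, hg, hg1, rfl⟩
  rw [hg.pairing_signedSub]
  exact (abs_sub _ _).trans (add_le_add (hb g hg hg1 μ) (hb g hg hg1 ν))

theorem blDist_comm (μ ν : FiniteMeasure S) : blDist μ ν = blDist ν μ := by
  have h : ∀ μ ν : FiniteMeasure S, blDist μ ν ≤ blDist ν μ := fun μ ν =>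
    blDist_le (blDist_nonneg _ _) fun f hf hf1 => by
      rw [abs_sub_comm]
      exact abs_integral_sub_le_blDist ν μ hf hf1
  exact le_antisymm (h μ ν) (h ν μ)

theorem blDist_triangle (μ ν ρ : FiniteMeasure S) :
    blDist μ ρ ≤ blDist μ ν + blDist ν ρ :=
  blDist_le (add_nonneg (blDist_nonneg _ _) (blDist_nonneg _ _)) fun _ hf hf1 =>
    (abs_sub_le _ _ _).trans
      (add_le_add (abs_integral_sub_le_blDist μ ν hf hf1) (abs_integral_sub_le_blDist ν ρ hf hf1))

/-! ### Weak continuity of the distance on tight sets. -/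

/-- A continuous partition of unity on a compact set, subordinate to small balls, turns integration
of functions in the unit ball of `BL(S,d)` into a finite linear combination of integrals of fixed
functions, up to a small error that is uniform in the function. -/
theorem exists_partition_approx {K : Set S} (hK : IsCompact K) {ε : ℝ} (hε : 0 < ε) :
    ∃ (t : Finset S) (φ : t → BoundedContinuousFunction S ℝ),
      ∀ f : S → ℝ, IsBL f → blNorm f ≤ 1 → ∀ ν : FiniteMeasure S,
        |(∫ x, f x ∂(ν : Measure S)) - ∑ i : t, f i * ∫ x, φ i x ∂(ν : Measure S)|
          ≤ ε * ν.mass + 2 * ν Kᶜ := by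
  obtain ⟨t, -, ht, hKt⟩ := hK.finite_cover_balls hε
  lift t to Finset S using ht
  obtain ⟨φ, hφ⟩ := PartitionOfUnity.exists_isSubordinate_of_locallyFinite hK.isClosed
    (fun i : t => Metric.ball (i : S) ε) (fun _ => Metric.isOpen_ball)
    (locallyFinite_of_finite _) (by simpa [iUnion_subtype] using hKt)
  have hsum1 : ∀ x ∈ K, ∑ i, φ i x = 1 := fun x hx => by
    rw [← finsum_eq_sum_of_fintype]; exact φ.sum_eq_one hx
  have hsum : ∀ x, ∑ i, φ i x ≤ 1 := fun x => by
    rw [← finsum_eq_sum_of_fintype]; exact φ.sum_le_one x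
  have hφb : ∀ i x, ‖φ i x‖ ≤ 1 := fun i x => by
    rw [Real.norm_of_nonneg (φ.nonneg i x)]; exact φ.le_one i x
  refine ⟨t, fun i => BoundedContinuousFunction.ofNormedAddCommGroup (φ i) (φ i).continuous 1
    (hφb i), fun f hf hf1 ν => ?_⟩
  simp only [BoundedContinuousFunction.coe_ofNormedAddCommGroup]
  have hfi : Integrable f (ν : Measure S) := by
    obtain ⟨C, hC⟩ := hf.1
    exact Integrable.of_bound hf.measurable.aestronglyMeasurable C (Eventually.of_forall hC)
  have hφi : ∀ i, Integrable (φ i) (ν : Measure S) := fun i =>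
    Integrable.of_bound (φ i).continuous.aestronglyMeasurable 1 (Eventually.of_forall (hφb i))
  have hmi : Integrable (fun x => ∑ i : t, f i * φ i x) (ν : Measure S) :=
    integrable_finsetSum _ fun i _ => (hφi i).const_mul _
  have hf1' : ∀ x, |f x| ≤ 1 := fun x => (hf.abs_le_blNorm x).trans hf1
  have hgoal : (∫ x, f x ∂(ν : Measure S)) - ∑ i : t, f i * ∫ x, φ i x ∂(ν : Measure S)
      = ∫ x, (f x - ∑ i : t, f i * φ i x) ∂(ν : Measure S) := by
    rw [integral_sub hfi hmi, integral_finsetSum _ fun i _ => (hφi i).const_mul _]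
    simp only [integral_const_mul]
  -- On `K` the weights sum to `1` and only centres within `ε` of `x` contribute; off `K` both terms
  -- are at most `1` in absolute value, hence the `2`.
  have hpt : ∀ x, ‖f x - ∑ i : t, f i * φ i x‖ ≤ ε + Kᶜ.indicator (fun _ => (2 : ℝ)) x := by
    intro x
    rw [Real.norm_eq_abs]
    by_cases hx : x ∈ K
    · rw [indicator_of_notMem (by simpa using hx), add_zero]
      have h1 : f x - ∑ i : t, f i * φ i x = ∑ i : t, (f x - f i) * φ i x := by
        simp only [sub_mul, Finset.sum_sub_distrib, ← Finset.mul_sum, hsum1 x hx, mul_one]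
      rw [h1]
      calc |∑ i : t, (f x - f i) * φ i x| ≤ ∑ i : t, |(f x - f i) * φ i x| :=
            Finset.abs_sum_le_sum_abs _ _
        _ ≤ ∑ i, ε * φ i x := by
            refine Finset.sum_le_sum fun i _ => ?_
            rw [abs_mul, abs_of_nonneg (φ.nonneg i x)]
            by_cases hi : φ i x = 0
            · simp [hi]
            have hxi : x ∈ Metric.ball (i : S) ε := hφ i (subset_closure hi)
            refine mul_le_mul_of_nonneg_right ?_ (φ.nonneg i x)
            have h2 := hf.abs_sub_le x i
            have h3 : dist x i < ε := hxi
            nlinarith [dist_nonneg (x := x) (y := (i : S))]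
        _ = ε := by rw [← Finset.mul_sum, hsum1 x hx, mul_one]
    · rw [indicator_of_mem (by simpa using hx)]
      have h1 : |∑ i : t, f i * φ i x| ≤ 1 := by
        refine (Finset.abs_sum_le_sum_abs _ _).trans (le_trans ?_ (hsum x))
        refine Finset.sum_le_sum fun i _ => ?_
        rw [abs_mul, abs_of_nonneg (φ.nonneg i x)]
        exact mul_le_of_le_one_left (φ.nonneg i x) (hf1' i)
      have h2 := abs_sub (f x) (∑ i : t, f i * φ i x)
      linarith [hf1' x]
  have hint : Integrable (fun x => ε + Kᶜ.indicator (fun _ => (2 : ℝ)) x) (ν : Measure S) :=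
    (integrable_const _).add ((integrable_const _).indicator hK.isClosed.measurableSet.compl)
  rw [hgoal, ← Real.norm_eq_abs]
  refine (norm_integral_le_of_norm_le hint (Eventually.of_forall hpt)).trans (le_of_eq ?_)
  rw [integral_add (integrable_const _)
    ((integrable_const _).indicator hK.isClosed.measurableSet.compl),
    integral_indicator hK.isClosed.measurableSet.compl]
  simp [FiniteMeasure.mass, mul_comm]

/-- On a uniformly tight set of measures of bounded mass, the bounded Lipschitz distance is
continuous for the weak topology. -/
theorem blDist_lt_mem_nhdsWithin {T : Set (FiniteMeasure S)} {C : ℝ≥0} {u : ℕ → ℝ≥0}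
    {K : ℕ → Set S} (hu : Tendsto u atTop (𝓝 0)) (hK : ∀ n, IsCompact (K n))
    (hT : ∀ ν ∈ T, ν.mass ≤ C ∧ ∀ n, ν (K n)ᶜ ≤ u n) {ρ : FiniteMeasure S} (hρ : ρ ∈ T)
    {δ : ℝ} (hδ : 0 < δ) : {ν | blDist ρ ν < δ} ∈ 𝓝[T] ρ := by
  -- The approximation error is at most `δ / 8` from the mass and `2 * (δ / 16)` from the tail. It
  -- occurs for `ρ` and for `ν`; with `δ / 4` for the finite sums the total is `3 * δ / 4`. Using `C
  -- + 1` avoids dividing by zero.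
  obtain ⟨n, hn⟩ : ∃ n, (u n : ℝ) < δ / 16 := by
    have : Tendsto (fun n => (u n : ℝ)) atTop (𝓝 0) := NNReal.tendsto_coe.2 hu
    exact (this.eventually (gt_mem_nhds (by positivity))).exists
  have hC : (0 : ℝ) < C + 1 := by positivity
  obtain ⟨t, φ, hφ⟩ := exists_partition_approx (hK n) (ε := δ / (8 * (C + 1))) (by positivity)
  have herr : ∀ ν ∈ T, δ / (8 * (C + 1)) * ν.mass + 2 * ν (K n)ᶜ ≤ δ / 4 := by
    intro ν hν
    have h1 : (ν.mass : ℝ) ≤ C + 1 := by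
      have : (ν.mass : ℝ) ≤ C := by exact_mod_cast (hT ν hν).1
      linarith
    have h2 : (ν (K n)ᶜ : ℝ) ≤ u n := by exact_mod_cast (hT ν hν).2 n
    have h3 : δ / (8 * (C + 1)) * ν.mass ≤ δ / (8 * (C + 1)) * (C + 1) := by gcongr
    have h4 : δ / (8 * ((C : ℝ) + 1)) * (C + 1) = δ / 8 := by field_simp
    linarith
  have hcont : Continuous fun ν : FiniteMeasure S =>
      ∑ i, |(∫ x, φ i x ∂(ρ : Measure S)) - ∫ x, φ i x ∂(ν : Measure S)| :=
    continuous_finsetSum _ fun i _ => (continuous_const.sub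
      (FiniteMeasure.continuous_integral_boundedContinuousFunction (φ i))).abs
  have hev : ∀ᶠ ν : FiniteMeasure S in 𝓝 ρ,
      ∑ i, |(∫ x, φ i x ∂(ρ : Measure S)) - ∫ x, φ i x ∂(ν : Measure S)| < δ / 4 :=
    hcont.continuousAt.eventually (gt_mem_nhds (by simpa using hδ))
  filter_upwards [mem_nhdsWithin_of_mem_nhds hev, self_mem_nhdsWithin] with ν hν hνT
  have hν' : ∑ i, |(∫ x, φ i x ∂(ρ : Measure S)) - ∫ x, φ i x ∂(ν : Measure S)| < δ / 4 := hν
  refine lt_of_le_of_lt (blDist_le (c := 3 * δ / 4) (by positivity) fun f hf hf1 => ?_)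
    (by linarith)
  have h1 := (hφ f hf hf1 ρ).trans (herr ρ hρ)
  have h2 := (hφ f hf hf1 ν).trans (herr ν hνT)
  have h3 : |(∑ i : t, f i * ∫ x, φ i x ∂(ρ : Measure S)) - ∑ i : t, f i * ∫ x, φ i x ∂(ν : Measure S)|
      ≤ δ / 4 := by
    rw [← Finset.sum_sub_distrib]
    refine (Finset.abs_sum_le_sum_abs _ _).trans (le_trans ?_ hν'.le)
    refine Finset.sum_le_sum fun i _ => ?_
    rw [← mul_sub, abs_mul]
    exact mul_le_of_le_one_left (abs_nonneg _) ((hf.abs_le_blNorm i).trans hf1)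
  rw [abs_le] at h1 h2 h3 ⊢
  constructor <;> linarith [h1.1, h1.2, h2.1, h2.2, h3.1, h3.2]

/-! ### Tightness from approximate tightness. -/

/-- Mass that `ν` puts far from a compact set is controlled by the mass outside of this set of a
measure close to `ν`. -/
theorem mul_measure_infDist_le {α ν : FiniteMeasure S} {K : Set S} (hK : IsCompact K) {r : ℝ}
    (hr : 0 < r) (hr1 : r ≤ 1) :
    r * ν {x | r ≤ Metric.infDist x K} ≤ r * α Kᶜ + 2 * blDist α ν := by
  -- `g` vanishes on `K` and equals `r` at distance at least `r`. As `r ≤ 1`, half of `g` has sup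
  -- norm and Lipschitz constant at most `1 / 2`, so it is an admissible test function; this halving
  -- gives the factor `2`.
  set g : S → ℝ := fun x => min r (Metric.infDist x K) with hg
  have hg0 : ∀ x, 0 ≤ g x := fun x => le_min hr.le Metric.infDist_nonneg
  have hgr : ∀ x, g x ≤ r := fun x => min_le_left _ _
  have hgl : LipschitzWith 1 g := (Metric.lipschitz_infDist_pt K).const_min r
  have hgi : ∀ ρ : FiniteMeasure S, Integrable g (ρ : Measure S) := fun ρ =>
    Integrable.of_bound hgl.continuous.aestronglyMeasurable r
      (Eventually.of_forall fun x => by rw [Real.norm_of_nonneg (hg0 x)]; exact hgr x)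
  have hfl : LipschitzWith (1 / 2) fun x => (1 / 2 : ℝ) * g x := by
    refine LipschitzWith.of_dist_le_mul fun x y => ?_
    have := hgl.dist_le_mul x y
    rw [Real.dist_eq] at this ⊢
    rw [← mul_sub, abs_mul, abs_of_pos (by norm_num : (0 : ℝ) < 1 / 2)]
    push_cast at this ⊢
    linarith
  have hfb : ∀ x, |(1 / 2 : ℝ) * g x| ≤ 1 / 2 := fun x => by
    rw [abs_of_nonneg (by have := hg0 x; positivity)]
    linarith [hgr x]
  have hd := abs_integral_sub_le_blDist α ν (f := fun x => (1 / 2 : ℝ) * g x)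
    ⟨⟨_, hfb⟩, _, hfl⟩
    ((blNorm_le (by norm_num) hfb hfl).trans (by push_cast; norm_num))
  rw [integral_const_mul, integral_const_mul, abs_le] at hd
  have hKm : MeasurableSet Kᶜ := hK.isClosed.measurableSet.compl
  have hFm : MeasurableSet {x | r ≤ Metric.infDist x K} :=
    (isClosed_le continuous_const (Metric.continuous_infDist_pt K)).measurableSet
  have hup : ∫ x, g x ∂(α : Measure S) ≤ r * α Kᶜ := by
    calc ∫ x, g x ∂(α : Measure S) ≤ ∫ x, Kᶜ.indicator (fun _ => r) x ∂(α : Measure S) := by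
          refine integral_mono (hgi α) ((integrable_const r).indicator hKm) fun x => ?_
          by_cases hx : x ∈ K
          · rw [indicator_of_notMem (by simpa using hx)]
            exact (min_le_right _ _).trans (Metric.infDist_zero_of_mem hx).le
          · rw [indicator_of_mem (by simpa using hx)]
            exact hgr x
      _ = r * α Kᶜ := by
          rw [integral_indicator hKm]
          simp [mul_comm]
  have hlow : r * ν {x | r ≤ Metric.infDist x K} ≤ ∫ x, g x ∂(ν : Measure S) := by
    calc r * ν {x | r ≤ Metric.infDist x K}
        = ∫ x, {x | r ≤ Metric.infDist x K}.indicator (fun _ => r) x ∂(ν : Measure S) := by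
          rw [integral_indicator hFm]
          simp [mul_comm]
      _ ≤ ∫ x, g x ∂(ν : Measure S) := by
          refine integral_mono ((integrable_const r).indicator hFm) (hgi ν) fun x => ?_
          by_cases hx : r ≤ Metric.infDist x K
          · rw [indicator_of_mem (by simpa using hx)]
            exact le_min le_rfl hx
          · rw [indicator_of_notMem (by simpa using hx)]
            exact hg0 x
  linarith [hd.1]

/-- A set of finite measures on a complete space that lies, in the bounded Lipschitz distance, in
arbitrarily small neighbourhoods of nearly tight sets is tight. -/
theorem isTightMeasureSet_of_forall_blDist_lt [CompleteSpace S] {A : Set (FiniteMeasure S)}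
    (h : ∀ ε : ℝ≥0, 0 < ε → ∀ η : ℝ, 0 < η → ∃ K : Set S, IsCompact K ∧
      ∀ ν ∈ A, ∃ α : FiniteMeasure S, α Kᶜ ≤ ε ∧ blDist α ν < η) :
    IsTightMeasureSet ((fun ν : FiniteMeasure S => (ν : Measure S)) '' A) := by
  rcases isEmpty_or_nonempty S with hS | ⟨⟨x₀⟩⟩
  · have : CompactSpace S := inferInstance
    exact IsTightMeasureSet.of_compactSpace
  have hthick : ∀ ε : ℝ≥0, 0 < ε → ∀ r : ℝ, 0 < r → r ≤ 1 → ∃ K : Set S, IsCompact K ∧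
      K.Nonempty ∧ ∀ ν ∈ A, ν {x | r ≤ Metric.infDist x K} ≤ ε := by
    intro ε hε r hr hr1
    have hε' : (0 : ℝ) < ε := hε
    obtain ⟨K, hK, hA⟩ := h (ε / 2) (half_pos hε) (r * ε / 4) (by positivity)
    -- `Metric.infDist` to the empty set is `0`, so an empty `K` would have all of `S` as its
    -- thickening; adding a point excludes this.
    refine ⟨insert x₀ K, hK.insert x₀, insert_nonempty _ _, fun ν hν => ?_⟩
    obtain ⟨α, hα, hαν⟩ := hA ν hν
    have h1 : α (insert x₀ K)ᶜ ≤ ε / 2 :=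
      (α.apply_mono (compl_subset_compl.2 (subset_insert _ _))).trans hα
    have h1' : (α (insert x₀ K)ᶜ : ℝ) ≤ ε / 2 := by exact_mod_cast h1
    have h2 := mul_measure_infDist_le (α := α) (ν := ν) (hK.insert x₀) hr hr1
    have h3 : r * α (insert x₀ K)ᶜ ≤ r * (ε / 2) := by gcongr
    have h4 : r * ν {x | r ≤ Metric.infDist x (insert x₀ K)} ≤ r * ε := by linarith
    exact_mod_cast le_of_mul_le_mul_left h4 hr
  rw [isTightMeasureSet_iff_exists_isCompact_measure_compl_le]
  intro ε hε
  obtain ⟨e, he, hesum⟩ := ENNReal.exists_pos_sum_of_countable hε.ne' ℕ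
  have hr : ∀ n : ℕ, (0 : ℝ) < 1 / ((n : ℝ) + 1) := fun n => by positivity
  have hr1 : ∀ n : ℕ, 1 / ((n : ℝ) + 1) ≤ 1 := fun n => by
    rw [div_le_one (by positivity)]
    linarith [n.cast_nonneg (α := ℝ)]
  choose K hK hKne hKA using fun n : ℕ => hthick (e n) (he n) (1 / ((n : ℝ) + 1)) (hr n) (hr1 n)
  -- An intersection of ever thinner closed thickenings of compact sets is closed and totally
  -- bounded, hence compact by completeness; the lost masses sum to less than `ε`.
  refine ⟨⋂ n, {x | Metric.infDist x (K n) ≤ 1 / ((n : ℝ) + 1)}, ?_, ?_⟩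
  · refine TotallyBounded.isCompact_of_isClosed ?_ (isClosed_iInter fun n =>
      isClosed_le (Metric.continuous_infDist_pt _) continuous_const)
    rw [Metric.totallyBounded_iff]
    intro δ hδ
    obtain ⟨n, hn⟩ := exists_nat_one_div_lt (half_pos hδ)
    obtain ⟨t, -, ht, hKt⟩ := (hK n).finite_cover_balls (half_pos hδ)
    refine ⟨t, ht, fun x hx => ?_⟩
    have hxn : Metric.infDist x (K n) ≤ 1 / ((n : ℝ) + 1) := mem_iInter.1 hx n
    obtain ⟨y, hy, hxy⟩ := (Metric.infDist_lt_iff (hKne n)).1 (hxn.trans_lt hn)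
    obtain ⟨z, hz, hyz⟩ := mem_iUnion₂.1 (hKt hy)
    refine mem_iUnion₂.2 ⟨z, hz, ?_⟩
    have hyz' : dist y z < δ / 2 := hyz
    exact (dist_triangle x y z).trans_lt (by linarith)
  · rintro _ ⟨ν, hν, rfl⟩
    rw [compl_iInter]
    refine (measure_iUnion_le _).trans (le_trans (ENNReal.tsum_le_tsum fun n => ?_) hesum.le)
    refine (measure_mono (t := {x | 1 / ((n : ℝ) + 1) ≤ Metric.infDist x (K n)})
      fun x (hx : ¬ Metric.infDist x (K n) ≤ 1 / ((n : ℝ) + 1)) => by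
        rw [mem_ofPred_eq]; exact (not_le.1 hx).le).trans ?_
    rw [← FiniteMeasure.ennreal_coeFn_eq_coeFn_toMeasure]
    exact_mod_cast hKA n ν hν

end BoundedLipschitz

/-! ### Equicontinuity and tightness of compositions. -/

section Families

variable {S : Type*} [MetricSpace S] [MeasurableSpace S] [BorelSpace S]

/-- The orbit of a measure under a tight family lies in a weakly compact set on which the bounded
Lipschitz distance is weakly continuous. -/
theorem TightFamily.exists_isCompact {Γ : Type*} {Q : Γ → MarkovOperator S} (hQ : TightFamily Q)
    (μ : FiniteMeasure S) : ∃ T : Set (FiniteMeasure S), IsCompact T ∧ (∀ g, Q g μ ∈ T) ∧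
      ∀ ρ ∈ T, ∀ δ : ℝ, 0 < δ → {ν | blDist ρ ν < δ} ∈ 𝓝[T] ρ := by
  obtain ⟨u, -, hupos, hu⟩ : ∃ u : ℕ → ℝ≥0, StrictAnti u ∧ (∀ n, 0 < u n) ∧
    Tendsto u atTop (𝓝 0) := exists_seq_strictAnti_tendsto 0
  have hQ' := isTightMeasureSet_iff_exists_isCompact_measure_compl_le.1 (hQ μ)
  choose K hK hKQ using fun n => hQ' (u n) (by exact_mod_cast hupos n)
  refine ⟨{ν | ν.mass = μ.mass ∧ ∀ n, ν (K n)ᶜ ≤ u n},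
    isCompact_setOfPred_finiteMeasure_mass_eq_compl_isCompact_le μ.mass hu hK
      (Or.inl inferInstance), fun g => ⟨(Q g).mass_map μ, fun n => ?_⟩, fun ρ hρ δ hδ => ?_⟩
  · have := hKQ n _ ⟨g, rfl⟩
    rw [← FiniteMeasure.ennreal_coeFn_eq_coeFn_toMeasure] at this
    exact_mod_cast this
  · exact blDist_lt_mem_nhdsWithin hu hK (fun ν hν => ⟨hν.1.le, hν.2⟩) hρ hδ

/-- Compactness of `T` makes the modulus uniform. The measure `ν` is not confined to `T`, which
matters because `Q g ν` need not lie there. -/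
theorem EquicontinuousFamily.exists_uniform {Λ : Type*} {P : Λ → MarkovOperator S}
    (hP : EquicontinuousFamily P) {T : Set (FiniteMeasure S)} (hT : IsCompact T)
    (hTn : ∀ ρ ∈ T, ∀ δ : ℝ, 0 < δ → {ν | blDist ρ ν < δ} ∈ 𝓝[T] ρ) {ε : ℝ} (hε : 0 < ε) :
    ∃ δ : ℝ, 0 < δ ∧ ∀ ρ ∈ T, ∀ ν, blDist ρ ν < δ → ∀ l, blDist (P l ρ) (P l ν) < ε := by
  refine hT.induction_on (p := fun s => ∃ δ : ℝ, 0 < δ ∧ ∀ ρ ∈ s, ∀ ν, blDist ρ ν < δ →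
    ∀ l, blDist (P l ρ) (P l ν) < ε) ⟨1, one_pos, by simp⟩ ?_ ?_ ?_
  · rintro s t hst ⟨δ, hδ, h⟩
    exact ⟨δ, hδ, fun ρ hρ => h ρ (hst hρ)⟩
  · rintro s t ⟨δ, hδ, h⟩ ⟨δ', hδ', h'⟩
    refine ⟨min δ δ', lt_min hδ hδ', ?_⟩
    rintro ρ (hρ | hρ) ν hν
    · exact h ρ hρ ν (hν.trans_le (min_le_left _ _))
    · exact h' ρ hρ ν (hν.trans_le (min_le_right _ _))
  · intro ρ hρ
    obtain ⟨δ, hδ, h⟩ := hP ρ (ε / 2) (half_pos hε)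
    -- Both `ρ'` and `ν` are then within `δ` of `ρ`, and their images are compared through `P l ρ`.
    refine ⟨_, hTn ρ hρ (δ / 2) (half_pos hδ), δ / 2, half_pos hδ, fun ρ' hρ' ν hν l => ?_⟩
    have hρ'' : blDist ρ ρ' < δ / 2 := hρ'
    have h1 : blDist (P l ρ) (P l ρ') < ε / 2 := h ρ' (by linarith) l
    have h2 : blDist (P l ρ) (P l ν) < ε / 2 :=
      h ν ((blDist_triangle ρ ρ' ν).trans_lt (by linarith)) l
    rw [blDist_comm] at h1
    exact (blDist_triangle _ (P l ρ) _).trans_lt (by linarith)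

theorem EquicontinuousFamily.comp {Λ Γ : Type*} {P : Λ → MarkovOperator S}
    {Q : Γ → MarkovOperator S} (hP : EquicontinuousFamily P) (hQ : EquicontinuousFamily Q)
    (hQt : TightFamily Q) :
    EquicontinuousFamily fun i : Λ × Γ => (P i.1).comp (Q i.2) := by
  intro μ ε hε
  obtain ⟨T, hT, hQT, hTn⟩ := hQt.exists_isCompact μ
  obtain ⟨η, hη, h⟩ := hP.exists_uniform hT hTn hε
  obtain ⟨δ, hδ, h'⟩ := hQ μ η hη
  exact ⟨δ, hδ, fun ν hν i => h _ (hQT i.2) _ (h' ν hν i.2) i.1⟩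

theorem TightFamily.comp [CompleteSpace S] {Λ Γ : Type*} {P : Λ → MarkovOperator S}
    {Q : Γ → MarkovOperator S} (hPt : TightFamily P) (hP : EquicontinuousFamily P)
    (hQt : TightFamily Q) :
    TightFamily fun i : Λ × Γ => (P i.1).comp (Q i.2) := by
  intro μ
  obtain ⟨T, hT, hQT, hTn⟩ := hQt.exists_isCompact μ
  suffices h : IsTightMeasureSet ((fun ν : FiniteMeasure S => (ν : Measure S)) ''
      {ν | ∃ ρ ∈ T, ∃ l, ν = P l ρ}) by
    refine h.subset ?_
    rintro _ ⟨i, rfl⟩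
    exact ⟨_, ⟨_, hQT i.2, i.1, rfl⟩, rfl⟩
  refine isTightMeasureSet_of_forall_blDist_lt fun ε hε η hη => ?_
  suffices h : ∃ K : Set S, IsCompact K ∧ ∀ ρ ∈ T, ∀ l, ∃ α : FiniteMeasure S,
      α Kᶜ ≤ ε ∧ blDist α (P l ρ) < η by
    obtain ⟨K, hK, h⟩ := h
    refine ⟨K, hK, ?_⟩
    rintro _ ⟨ρ, hρ, l, rfl⟩
    exact h ρ hρ l
  refine hT.induction_on (p := fun s => ∃ K : Set S, IsCompact K ∧ ∀ ρ ∈ s, ∀ l,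
    ∃ α : FiniteMeasure S, α Kᶜ ≤ ε ∧ blDist α (P l ρ) < η) ⟨∅, isCompact_empty, by simp⟩ ?_ ?_ ?_
  · rintro s t hst ⟨K, hK, h⟩
    exact ⟨K, hK, fun ρ hρ => h ρ (hst hρ)⟩
  · rintro s t ⟨K, hK, h⟩ ⟨K', hK', h'⟩
    refine ⟨K ∪ K', hK.union hK', ?_⟩
    rintro ρ (hρ | hρ) l
    · obtain ⟨α, hα, hd⟩ := h ρ hρ l
      exact ⟨α, (α.apply_mono (compl_subset_compl.2 subset_union_left)).trans hα, hd⟩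
    · obtain ⟨α, hα, hd⟩ := h' ρ hρ l
      exact ⟨α, (α.apply_mono (compl_subset_compl.2 subset_union_right)).trans hα, hd⟩
  · intro ρ hρ
    obtain ⟨δ, hδ, h⟩ := hP ρ η hη
    obtain ⟨K, hK, hKP⟩ := isTightMeasureSet_iff_exists_isCompact_measure_compl_le.1 (hPt ρ) ε
      (by exact_mod_cast hε)
    -- The image of the centre, `P l ρ`, serves as the approximant for every `ρ'` near `ρ`.
    refine ⟨_, hTn ρ hρ δ hδ, K, hK, fun ρ' hρ' l => ⟨P l ρ, ?_, h ρ' hρ' l⟩⟩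
    have := hKP _ ⟨l, rfl⟩
    rw [← FiniteMeasure.ennreal_coeFn_eq_coeFn_toMeasure] at this
    exact_mod_cast this

/-- Induction peels off the leftmost factor, the remaining product taking the role of `Q`. Both
properties are carried together, since composing on the left requires the product to be tight. -/
theorem equicontinuousFamily_and_tightFamily_compFin [CompleteSpace S]
    [TopologicalSpace.SeparableSpace S] :
    ∀ (n : ℕ) (Λ : Fin n → Type*) (P : ∀ i, Λ i → MarkovOperator S),
      (∀ i, EquicontinuousFamily (P i)) → (∀ i, TightFamily (P i)) →
      EquicontinuousFamily (fun l : ∀ i, Λ i => MarkovOperator.compFin fun i => P i (l i)) ∧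
      TightFamily (fun l : ∀ i, Λ i => MarkovOperator.compFin fun i => P i (l i)) := by
  intro n
  induction n with
  | zero =>
    intro Λ P _ _
    have hid : ∀ l : (∀ i, Λ i),
        (MarkovOperator.compFin fun i => P i (l i)) = MarkovOperator.id := fun l => by
      simp [MarkovOperator.compFin]
    simp only [hid]
    refine ⟨fun μ ε hε => ⟨ε, hε, fun ν hν _ => hν⟩, fun μ => ?_⟩
    -- For the identity, tightness means that each single finite measure is tight; separability and
    -- completeness give this.
    have : SecondCountableTopology S := UniformSpace.secondCountable_of_separable S
    refine (isTightMeasureSet_singleton (μ := (μ : Measure S))).subset ?_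
    rintro _ ⟨l, rfl⟩
    rfl
  | succ n ih =>
    intro Λ P hP hPt
    obtain ⟨hE, hTt⟩ := ih (fun i => Λ i.succ) (fun i => P i.succ) (fun i => hP _) fun i => hPt _
    have hcomp : ∀ l : (∀ i, Λ i), (MarkovOperator.compFin fun i => P i (l i))
        = (P 0 (l 0)).comp (MarkovOperator.compFin fun i : Fin n => P i.succ (l i.succ)) :=
      fun l => by simp [MarkovOperator.compFin, List.ofFn_succ]
    simp only [hcomp]
    have hE' := (hP 0).comp hE hTt
    have hT' := (hPt 0).comp (hP 0) hTt
    refine ⟨fun μ ε hε => ?_, fun μ => (hT' μ).subset ?_⟩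
    · obtain ⟨δ, hδ, h⟩ := hE' μ ε hε
      exact ⟨δ, hδ, fun ν hν l => h ν hν (l 0, fun i => l i.succ)⟩
    · rintro _ ⟨l, rfl⟩
      exact ⟨(l 0, fun i => l i.succ), rfl⟩

end Families

end MarkovComposition

theorem theorem2p1 {S : Type*} [MetricSpace S] [CompleteSpace S]
    [TopologicalSpace.SeparableSpace S] [MeasurableSpace S] [BorelSpace S] :
    (∀ (Λ : Type*) (Γ : Type*) (P : Λ → MarkovComposition.MarkovOperator S)
        (Q : Γ → MarkovComposition.MarkovOperator S),
      MarkovComposition.EquicontinuousFamily P →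
      MarkovComposition.EquicontinuousFamily Q →
      MarkovComposition.TightFamily Q →
      MarkovComposition.EquicontinuousFamily (fun i : Λ × Γ => (P i.1).comp (Q i.2)) ∧
      (MarkovComposition.TightFamily P →
        MarkovComposition.TightFamily (fun i : Λ × Γ => (P i.1).comp (Q i.2)))) ∧
    (∀ (n : ℕ) (Λ : Fin n → Type*) (P : ∀ i, Λ i → MarkovComposition.MarkovOperator S),
      (∀ i, MarkovComposition.EquicontinuousFamily (P i)) →
      (∀ i, MarkovComposition.TightFamily (P i)) →
      MarkovComposition.EquicontinuousFamily (fun l : ∀ i, Λ i =>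
        MarkovComposition.MarkovOperator.compFin fun i => P i (l i)) ∧
      MarkovComposition.TightFamily (fun l : ∀ i, Λ i =>
        MarkovComposition.MarkovOperator.compFin fun i => P i (l i))) := by
  exact ⟨fun Λ Γ P Q hP hQ hQt => ⟨hP.comp hQ hQt, fun hPt => hPt.comp hP hQt⟩,
    fun n Λ P hP hPt =>
      MarkovComposition.equicontinuousFamily_and_tightFamily_compFin n Λ P hP hPt⟩
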